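/- \textbf{Model.} There are $N$ servers, each with a queue of buffer size $b$ (the task in service included). Jobs arrive as a Poisson process of rate $N\lambda/k$; each job consists of $k$ tasks whose service times are independent exponentials with rate $1$; every busy server works at rate $1$. Under \emph{batch-filling with probe overhead $d$}, an arriving job samples uniformly at random, without replacement, a set of $kd$ of the $N$ queues (with $kd$ rounded down to an integer, which is assumed to be at most $N$), and its $k$ tasks are assigned one by one to a shortest sampled queue, the queue lengths being updated after each assignment; if some task would be put into a queue that already holds $b$ tasks, the whole job is dropped. Let $S_i(t)$ be the fraction of servers with at least $i$ tasks at time $t$. Then $(S_0(t),\dots,S_b(t))$ is a continuous-time Markov chain on the finite set of all $(s_0,\dots,s_b)$ with $1=s_0\ge s_1\ge\dots\ge s_b\ge 0$ and $Ns_i\in\mathbb{N}$; let $S=(S_0,\dots,S_b)$ be distributed according to its stationary distribution. \textbf{Theorem.} Let $0<\alpha<\tfrac12$ and $0<\beta\le 1$ be constants, let $\lambda=1-\beta N^{-\alpha}$, and let $k=k(N)\in\mathbb{N}$, $h=h(N)\in\mathbb{R}$ and $d=d(N)\in\mathbb{R}$ be such that, as $N\to\infty$, $$k=o\!\left(\frac{N^{1/2-\alpha}}{\log^2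 N}\right),\qquad \frac{k}{\log k}=\Omega(\log N),\qquad h=o(\log k),\qquad h\to\infty,$$ and, for all large $N$, $d\ge \frac{8}{(1-\lambda)h}$ and $\lfloor kd\rfloor\le N$. Let the buffer size be $b=\min\{N^{\alpha},\,N^{1/2-\alpha}/k\}$, rounded down to an integer. Then, for all sufficiently large $N$, under batch-filling with probe overhead $d$, $$\mathbb{E}\left[\max\left\{\sum_{i=1}^b S_i-h\left(1-\tfrac12\beta N^{-\alpha}\right),\,0\right\}\right]\le\frac{5}{\sqrt N\,\log N}.$$ -/

import Mathlib

open Filter Asymptotics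

namespace BatchFilling

noncomputable section

open scoped Classical in
/-- One round of batch-filling: a task joins a shortest queue among the sampled queues `A`.
(Which of several shortest queues is taken does not influence the fractions of servers
with at least `i` tasks.) -/
def joinShortest {N : ℕ} (A : Finset (Fin N)) (q : Fin N → ℕ) : Fin N → ℕ :=
  if hA : A.Nonempty then
    let n := (A.exists_min_image q hA).choose
    Function.update q n (q n + 1)
  else q

/-- Batch-filling: `k` tasks join one by one the shortest queue among the sampled queues `A`,
the queue lengths being updated after every assignment. -/
def batchFill {N : ℕ} (A : Finset (Fin N)) : ℕ → (Fin N → ℕ) → (Fin N → ℕ)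
  | 0, q => q
  | k + 1, q => batchFill A k (joinShortest A q)

/-- A task leaves server `n`. -/
def depart {N : ℕ} (q : Fin N → ℕ) (n : Fin N) : Fin N → ℕ :=
  Function.update q n (q n - 1)

/-- The state space of the Markov chain `S(t) = (S_0(t), …, S_b(t))`, stored through the integers
`c i = N * s_i`: sequences `N = c 0 ≥ c 1 ≥ ⋯ ≥ c b ≥ 0`. -/
abbrev State (N b : ℕ) : Type :=
  {c : Fin (b + 1) → Fin (N + 1) // c 0 = Fin.last N ∧ Antitone c}

/-- The coordinate `s_i`: the fraction of servers that have at least `i` tasks. -/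
def State.frac {N b : ℕ} (s : State N b) (i : Fin (b + 1)) : ℝ := (s.1 i : ℕ) / (N : ℝ)

/-- `∑_{i=1}^b s_i`, the average number of tasks per server. -/
def State.total {N b : ℕ} (s : State N b) : ℝ := ∑ i : Fin b, s.frac i.succ

/-- The state of a system with queue lengths `q n`: `N s_i` is the number of servers
with at least `i` tasks. -/
def toState {N : ℕ} (b : ℕ) (q : Fin N → ℕ) : State N b :=
  ⟨fun i => ⟨(Finset.univ.filter fun n => (i : ℕ) ≤ q n).card,
      Nat.lt_succ_of_le ((Finset.card_le_univ _).trans_eq (Fintype.card_fin N))⟩,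
    by simp [Fin.ext_iff],
    fun i j hij => Finset.card_le_card fun n hn => by
      simp only [Finset.mem_filter, Finset.mem_univ, true_and] at hn ⊢
      exact le_trans hij hn⟩

/-- Queue lengths of the `N` servers in state `s`, the servers being listed in order of
non-increasing queue length. -/
def State.queues {N b : ℕ} (s : State N b) : Fin N → ℕ :=
  fun n => (Finset.univ.filter fun i : Fin b => (n : ℕ) < (s.1 i.succ : ℕ)).card

/-- `s.queues` is indeed a configuration of queue lengths whose state is `s`. -/
theorem toState_queues {N b : ℕ} (s : State N b) : toState b s.queues = s := by
  apply Subtype.ext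
  funext i
  apply Fin.ext
  have key : ∀ n : Fin N, ((i : ℕ) ≤ s.queues n ↔ (n : ℕ) < (s.1 i : ℕ)) := by
    intro n
    constructor
    · intro hi
      by_contra hn
      have hsub : (Finset.univ.filter fun j : Fin b => (n : ℕ) < (s.1 j.succ : ℕ)) ⊆
          Finset.univ.filter fun j : Fin b => (j : ℕ) + 1 < (i : ℕ) := by
        intro j hj
        simp only [Finset.mem_filter, Finset.mem_univ, true_and] at hj ⊢
        by_contra hji
        have h1 : i ≤ j.succ := by rw [Fin.le_def, Fin.val_succ]; omega
        have h2 : (s.1 j.succ : ℕ) ≤ (s.1 i : ℕ) := s.2.2 h1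
        omega
      have hpos : 0 < (i : ℕ) := by
        rcases Nat.eq_zero_or_pos (i : ℕ) with h0 | h0
        · have : i = 0 := Fin.ext h0
          rw [this, s.2.1] at hn
          simp at hn
        · exact h0
      have hc : (Finset.univ.filter fun j : Fin b => (j : ℕ) + 1 < (i : ℕ)).card ≤ (i : ℕ) - 1 := by
        have := Finset.card_le_card_of_injOn (s := Finset.univ.filter fun j : Fin b =>
          (j : ℕ) + 1 < (i : ℕ)) (t := Finset.range ((i : ℕ) - 1)) (fun j => (j : ℕ))
          (fun j hj => by simp at hj ⊢; omega) (fun a _ c _ hac => Fin.ext hac)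
        simpa using this
      have := hi.trans ((Finset.card_le_card hsub).trans hc)
      omega
    · intro hn
      have := Finset.card_le_card_of_injOn (s := (Finset.univ : Finset (Fin (i : ℕ))))
        (t := Finset.univ.filter fun j : Fin b => (n : ℕ) < (s.1 j.succ : ℕ))
        (fun j => ⟨(j : ℕ), by omega⟩)
        (fun j _ => by
          simp only [Finset.coe_filter, Finset.mem_univ, true_and, Set.mem_ofPred_eq]
          refine lt_of_lt_of_le hn (s.2.2 ?_)
          rw [Fin.le_def, Fin.val_succ]
          exact j.2)
        (fun a _ c _ hac => Fin.ext (by simpa using hac))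
      rw [Finset.card_univ, Fintype.card_fin] at this
      exact this
  change (Finset.univ.filter fun n : Fin N => (i : ℕ) ≤ s.queues n).card = (s.1 i : ℕ)
  simp only [key]
  have hle : (s.1 i : ℕ) ≤ N := by omega
  rw [Fin.card_filter_val_lt]
  omega

open scoped Classical in
/-- The transition rate of `S(t)` from `s` to `s'` for `N` servers with buffers of size `b`, load
`lam`, jobs of `k` tasks and `m` sampled queues per job. Every busy server completes a task at
rate `1`. Jobs arrive at rate `N * lam / k`; a job samples a uniformly random set `A` of `m`
queues and is admitted if no task is put into a queue that is full already, and it is dropped as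
a whole otherwise. -/
def rate (N b k m : ℕ) (lam : ℝ) (s s' : State N b) : ℝ :=
  ((Finset.univ.filter fun n : Fin N =>
      0 < s.queues n ∧ toState b (depart s.queues n) = s').card : ℝ) +
  (N : ℝ) * lam / k *
    ((((Finset.univ : Finset (Fin N)).powersetCard m).filter fun A =>
        (∀ n, batchFill A k s.queues n ≤ b) ∧
          toState b (batchFill A k s.queues) = s').card / (N.choose m : ℝ))

/-- `p` is a stationary distribution of the continuous-time Markov chain `S(t)`: a probability
vector that satisfies the global balance equations. -/
structure IsStationary (N b k m : ℕ) (lam : ℝ) (p : State N b → ℝ) : Prop where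
  nonneg : ∀ s, 0 ≤ p s
  sum_eq_one : ∑ s, p s = 1
  balance : ∀ s, p s * ∑ s' ∈ Finset.univ.erase s, rate N b k m lam s s' =
    ∑ s' ∈ Finset.univ.erase s, p s' * rate N b k m lam s' s

/-- The load `1 - β N^{-α}`. -/
def load (α β : ℝ) (N : ℕ) : ℝ := 1 - β * (N : ℝ) ^ (-α)

/-- The buffer size `min {N^α, N^{1/2-α} / k}`, rounded down to an integer. -/
def bufferSize (α : ℝ) (N k : ℕ) : ℕ :=
  ⌊min ((N : ℝ) ^ α) ((N : ℝ) ^ (1 / 2 - α) / k)⌋₊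

end

end BatchFilling

/-!
Write `1 - ε` for the load, `H = ⌊h⌋` and `τ = log N / √N`. Let the *excess* count the tasks at
positions above `H` and the *deficit* the free positions up to `H`. The Lyapunov function is the sum
of `exp (τ * excess)` and of a normalized `exp (τ * number of tasks)`.

If the deficit is less than about `ε * H * N`, then fewer than `ε * N` servers are idle, departures
outpace arrivals and the number of tasks decreases. If the deficit is of this order or more, then a
sample of `k * d ≥ 8 * k / (ε * h)` queues has on average several times `k` free positions below
level `H`, and a Chernoff bound shows that with high probability it has at least `k`; then the whole
job fits below `H` and the excess does not increase. The Chernoff bound for sampling without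
replacement follows from Maclaurin's inequality for the numbers `exp (-a i)`.

The two exponentials balance at the deficit `3 / 4 * (ε * H * N)`, so the Lyapunov function has
negative drift everywhere up to a constant and its stationary mean is at most `8`. A state in which
the number of tasks per server exceeds `H * (1 - ε / 2)` gives the Lyapunov function a value of at
least `exp (τ * ε * H * N / 4)`, which is superpolynomially large.
-/

namespace BatchFilling

open Finset

theorem succ_mul_pow_mul_le {R : Type*} [CommRing R] [LinearOrder R] [IsStrictOrderedRing R]
    {x y : R} (hx : 0 ≤ x) (hy : 0 ≤ y) (m : ℕ) :
    (m + 1) * x ^ m * y ≤ y ^ (m + 1) + m * x ^ (m + 1) := by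
  induction m with
  | zero => simp
  | succ m ih =>
    have hstep := mul_le_mul_of_nonneg_right ih hy
    have hsq : 0 ≤ (m + 1) * x ^ m * (y - x) ^ 2 := by positivity
    push_cast
    linear_combination hstep + hsq

section Maclaurin

variable {𝕜 : Type*} [Field 𝕜] [LinearOrder 𝕜] [IsStrictOrderedRing 𝕜]

theorem choose_mul_pow_add_mul_le {a μ : 𝕜} (ha : 0 ≤ a) (hμ : 0 ≤ μ) (n m : ℕ) :
    n.choose (m + 1) * μ ^ (m + 1) + a * (n.choose m * μ ^ m) ≤
      (n + 1).choose (m + 1) * ((a + n * μ) / (n + 1)) ^ (m + 1) := by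
  set ν := (a + n * μ) / (n + 1) with hν
  have hν0 : 0 ≤ ν := by positivity
  have ha_eq : a = (n + 1) * ν - n * μ := by rw [hν]; field_simp; ring
  have hpascal : ((n + 1).choose (m + 1) : 𝕜) = n.choose m + n.choose (m + 1) :=
    mod_cast Nat.choose_succ_succ n m
  have habsorb : ((n : 𝕜) + 1) * n.choose m = (n + 1).choose (m + 1) * (m + 1) :=
    mod_cast Nat.add_one_mul_choose_eq n m
  calc n.choose (m + 1) * μ ^ (m + 1) + a * (n.choose m * μ ^ m)
      = (n + 1).choose (m + 1) * ((m + 1) * μ ^ m * ν - m * μ ^ (m + 1)) := by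
        rw [ha_eq]
        linear_combination μ ^ m * (ν - μ) * habsorb - μ ^ (m + 1) * hpascal
    _ ≤ (n + 1).choose (m + 1) * ν ^ (m + 1) := by
        gcongr
        linarith [succ_mul_pow_mul_le hμ hν0 m]

theorem esymm_le_choose_mul_pow (s : Multiset 𝕜) (hs : ∀ x ∈ s, 0 ≤ x) (m : ℕ) :
    s.esymm m ≤ s.card.choose m * (s.sum / s.card) ^ m := by
  induction s using Multiset.induction generalizing m with
  | empty => cases m <;> simp [Multiset.esymm, Multiset.powersetCard_zero_right]
  | cons a s ih =>
    cases m with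
    | zero => simp [Multiset.esymm]
    | succ m =>
      obtain ⟨ha, hs⟩ := Multiset.forall_mem_cons.1 hs
      have hmean : 0 ≤ s.sum / s.card := div_nonneg (Multiset.sum_nonneg hs) s.card.cast_nonneg
      have hsum : s.sum = s.card * (s.sum / s.card) := by
        rcases eq_or_ne s 0 with rfl | h
        · simp
        · rw [mul_div_cancel₀]
          exact_mod_cast Multiset.card_eq_zero.not.2 h
      calc (a ::ₘ s).esymm (m + 1) = s.esymm (m + 1) + a * s.esymm m := by
            simp [Multiset.esymm, Multiset.powersetCard_cons, Multiset.sum_map_mul_left]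
        _ ≤ s.card.choose (m + 1) * (s.sum / s.card) ^ (m + 1) +
              a * (s.card.choose m * (s.sum / s.card) ^ m) := by
            gcongr
            exacts [ih hs _, ih hs _]
        _ ≤ (s.card + 1).choose (m + 1) *
              ((a + s.card * (s.sum / s.card)) / (s.card + 1)) ^ (m + 1) :=
            choose_mul_pow_add_mul_le ha hmean _ _
        _ = _ := by
            rw [← hsum, Multiset.card_cons, Multiset.sum_cons, Nat.cast_succ]

theorem sum_powersetCard_prod_le {ι : Type*} {S : Finset ι} {x : ι → 𝕜} (hx : ∀ i ∈ S, 0 ≤ x i)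
    (m : ℕ) :
    ∑ A ∈ S.powersetCard m, ∏ i ∈ A, x i ≤ (#S).choose m * ((∑ i ∈ S, x i) / #S) ^ m := by
  have h := esymm_le_choose_mul_pow (S.val.map x) (by simpa using hx) m
  rwa [esymm_map_val, Multiset.card_map] at h

end Maclaurin

theorem exp_neg_le_one_sub_half {u : ℝ} (h0 : 0 ≤ u) (h1 : u ≤ 1) : Real.exp (-u) ≤ 1 - u / 2 := by
  calc Real.exp (-u) ≤ (u + 1)⁻¹ := by
        rw [Real.exp_neg]
        exact inv_anti₀ (by positivity) (Real.add_one_le_exp u)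
    _ ≤ 1 - u / 2 := by
        rw [inv_le_iff_one_le_mul₀ (by positivity)]
        nlinarith

theorem sum_exp_neg_div_card_le {ι : Type*} {S : Finset ι} {a : ι → ℝ}
    (ha : ∀ i ∈ S, a i ∈ Set.Icc 0 1) :
    (∑ i ∈ S, Real.exp (-a i)) / #S ≤ Real.exp (-((∑ i ∈ S, a i) / #S / 2)) := by
  rcases S.eq_empty_or_nonempty with rfl | hS
  · simp
  have hcard : (#S : ℝ) ≠ 0 := mod_cast hS.card_pos.ne'
  calc (∑ i ∈ S, Real.exp (-a i)) / #S ≤ (∑ i ∈ S, (1 - a i / 2)) / #S := by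
        gcongr with i hi
        exact exp_neg_le_one_sub_half (ha i hi).1 (ha i hi).2
    _ = -((∑ i ∈ S, a i) / #S / 2) + 1 := by
        rw [sum_sub_distrib, ← sum_div, sum_const, nsmul_one, sub_div, div_self hcard]
        ring
    _ ≤ _ := Real.add_one_le_exp _

theorem sum_powersetCard_exp_neg_sum_le {ι : Type*} {S : Finset ι} {a : ι → ℝ}
    (ha : ∀ i ∈ S, a i ∈ Set.Icc 0 1) (m : ℕ) :
    ∑ A ∈ S.powersetCard m, Real.exp (-∑ i ∈ A, a i) ≤
      (#S).choose m * Real.exp (-(m * ((∑ i ∈ S, a i) / #S) / 2)) := by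
  calc ∑ A ∈ S.powersetCard m, Real.exp (-∑ i ∈ A, a i)
      = ∑ A ∈ S.powersetCard m, ∏ i ∈ A, Real.exp (-a i) := by
        simp only [← Real.exp_sum, sum_neg_distrib]
    _ ≤ (#S).choose m * ((∑ i ∈ S, Real.exp (-a i)) / #S) ^ m :=
        sum_powersetCard_prod_le (fun i _ => Real.exp_nonneg _) m
    _ ≤ (#S).choose m * Real.exp (-((∑ i ∈ S, a i) / #S / 2)) ^ m := by
        gcongr
        exact sum_exp_neg_div_card_le ha
    _ = _ := by
        rw [← Real.exp_nat_mul]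
        ring_nf

theorem card_filter_sum_le_le {ι : Type*} {S : Finset ι} {a : ι → ℝ}
    (ha : ∀ i ∈ S, a i ∈ Set.Icc 0 1) (m : ℕ) (t : ℝ) :
    (#{A ∈ S.powersetCard m | ∑ i ∈ A, a i ≤ t} : ℝ) ≤
      (#S).choose m * Real.exp (t - m * ((∑ i ∈ S, a i) / #S) / 2) := by
  calc (#{A ∈ S.powersetCard m | ∑ i ∈ A, a i ≤ t} : ℝ)
      ≤ ∑ A ∈ S.powersetCard m, Real.exp t * Real.exp (-∑ i ∈ A, a i) := by
        rw [card_filter, Nat.cast_sum]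
        gcongr with A
        rw [← Real.exp_add, ← sub_eq_add_neg]
        split_ifs with h
        · exact_mod_cast Real.one_le_exp (sub_nonneg.2 h)
        · exact_mod_cast Real.exp_nonneg _
    _ ≤ Real.exp t * ((#S).choose m * Real.exp (-(m * ((∑ i ∈ S, a i) / #S) / 2))) := by
        rw [← mul_sum]
        gcongr
        exact sum_powersetCard_exp_neg_sum_le ha m
    _ = _ := by
        rw [sub_eq_add_neg, Real.exp_add]
        ring

theorem sum_mul_generator_eq_zero {σ R : Type*} [Fintype σ] [DecidableEq σ] [CommRing R]
    {p : σ → R} {Q : σ → σ → R}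
    (hp : ∀ s, p s * ∑ s' ∈ univ.erase s, Q s s' = ∑ s' ∈ univ.erase s, p s' * Q s' s)
    (f : σ → R) : ∑ s, p s * ∑ s', Q s s' * (f s' - f s) = 0 := by
  have hbalance : ∀ s, p s * ∑ s', Q s s' = ∑ s', p s' * Q s' s := fun s => by
    rw [← add_sum_erase _ _ (mem_univ s), ← add_sum_erase univ (fun s' => p s' * Q s' s)
      (mem_univ s), mul_add, hp]
  have hinflow : ∑ s, p s * ∑ s', Q s s' * f s' = ∑ s, (∑ s', p s' * Q s' s) * f s := by
    simp only [mul_sum, sum_mul, mul_assoc]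
    exact sum_comm
  have houtflow : ∑ s, p s * ∑ s', Q s s' * f s = ∑ s, (∑ s', p s' * Q s' s) * f s := by
    simp only [← sum_mul, ← mul_assoc, hbalance]
  simp only [mul_sub, sum_sub_distrib, hinflow, houtflow, sub_self]

theorem sum_card_fiber_mul {ι σ R : Type*} [Fintype σ] [DecidableEq σ] [Semiring R] (S : Finset ι)
    (P : ι → Prop) [DecidablePred P] (F : ι → σ) (g : σ → R) :
    ∑ s, (#{i ∈ S | P i ∧ F i = s} : R) * g s = ∑ i ∈ S with P i, g (F i) := by
  simp only [← sum_fiberwise' {i ∈ S | P i} F g, filter_filter, sum_const, nsmul_eq_mul]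

theorem sum_comp_eq_of_card_le_eq {ι M : Type*} [Fintype ι] [AddCommMonoid M] {q q' : ι → ℕ}
    (h : ∀ i, #{n | i ≤ q n} = #{n | i ≤ q' n}) (g : ℕ → M) : ∑ n, g (q n) = ∑ n, g (q' n) := by
  have hfiber : ∀ (r : ι → ℕ) (i : ℕ), #{n | i = r n} + #{n | i + 1 ≤ r n} = #{n | i ≤ r n} := by
    intro r i
    classical
    rw [← card_union_of_disjoint (disjoint_filter.2 fun _ _ _ => by omega), ← filter_or]
    exact congrArg card (filter_congr fun _ _ => by omega)
  have hmap : univ.val.map q = univ.val.map q' := by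
    ext i
    rw [Multiset.count_map, Multiset.count_map]
    exact Nat.add_right_cancel ((hfiber q i).trans ((h i).trans ((h (i + 1)) ▸ (hfiber q' i).symm)))
  simpa using congrArg (fun s => (s.map g).sum) hmap

section State

variable {N b : ℕ}

theorem State.queues_le (s : State N b) (n : Fin N) : s.queues n ≤ b :=
  (card_le_univ _).trans_eq (Fintype.card_fin b)

theorem card_le_queues_toState {q : Fin N → ℕ} (hq : ∀ n, q n ≤ b) (i : ℕ) :
    #{n | i ≤ (toState b q).queues n} = #{n | i ≤ q n} := by
  rcases le_or_gt i b with hi | hi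
  · exact congrArg (fun s : State N b => (s.1 ⟨i, Nat.lt_succ_of_le hi⟩ : ℕ))
      (toState_queues (toState b q))
  · rw [filter_false_of_mem fun n _ => not_le.2 ((State.queues_le _ n).trans_lt hi),
      filter_false_of_mem fun n _ => not_le.2 ((hq n).trans_lt hi)]

theorem sum_queues_toState {M : Type*} [AddCommMonoid M] {q : Fin N → ℕ} (hq : ∀ n, q n ≤ b)
    (g : ℕ → M) : ∑ n, g ((toState b q).queues n) = ∑ n, g (q n) :=
  sum_comp_eq_of_card_le_eq (card_le_queues_toState hq) g

theorem State.sum_queues (s : State N b) : ∑ n, s.queues n = ∑ i : Fin b, (s.1 i.succ : ℕ) := by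
  unfold State.queues
  refine (sum_card_bipartiteAbove_eq_sum_card_bipartiteBelow
    fun (n : Fin N) (i : Fin b) => (n : ℕ) < s.1 i.succ).trans (sum_congr rfl fun i _ => ?_)
  rw [bipartiteBelow, Fin.card_filter_val_lt]
  exact min_eq_right (Nat.lt_succ_iff.1 (s.1 i.succ).2)

theorem State.total_eq (s : State N b) : s.total = (∑ n, s.queues n : ℕ) / N := by
  rw [s.sum_queues, Nat.cast_sum, sum_div]
  rfl

end State

section Excess

/-- The number of tasks at positions above level `H`. With `H = 0` it is the number of all tasks in
the system. -/
def excess {N : ℕ} (H : ℕ) (q : Fin N → ℕ) : ℕ := ∑ n, (q n - H)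

/-- The number of free positions up to level `H`. -/
def deficit {N : ℕ} (H : ℕ) (q : Fin N → ℕ) : ℕ := ∑ n, (H - q n)

variable {N : ℕ} (H k : ℕ) (A : Finset (Fin N)) (q : Fin N → ℕ)

theorem excess_zero_add_deficit : excess 0 q + deficit H q = excess H q + N * H := by
  have hlevel : N * H = ∑ _n : Fin N, H := by simp
  rw [hlevel, excess, excess, deficit, ← sum_add_distrib, ← sum_add_distrib]
  exact sum_congr rfl fun n _ => by omega

theorem mul_card_idle_le_deficit : H * #{n | q n = 0} ≤ deficit H q := by
  calc H * #{n | q n = 0} = ∑ n with q n = 0, (H - q n) := by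
        rw [mul_comm, ← smul_eq_mul, ← sum_const]
        exact sum_congr rfl fun n hn => by rw [(mem_filter.1 hn).2, Nat.sub_zero]
    _ ≤ deficit H q := sum_le_sum_of_subset (filter_subset _ _)

theorem excess_toState {b : ℕ} {q : Fin N → ℕ} (hq : ∀ n, q n ≤ b) :
    excess H (toState b q).queues = excess H q :=
  sum_queues_toState hq fun i => i - H

theorem sum_comp_update {ι M : Type*} [DecidableEq ι] [AddCommMonoid M] {S : Finset ι} {n : ι}
    (hn : n ∈ S) (g : ℕ → M) (q : ι → ℕ) (v : ℕ) :
    ∑ i ∈ S, g (Function.update q n v i) + g (q n) = ∑ i ∈ S, g (q i) + g v := by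
  have hrest : ∑ i ∈ S.erase n, g (Function.update q n v i) = ∑ i ∈ S.erase n, g (q i) :=
    sum_congr rfl fun i hi => by rw [Function.update_of_ne (ne_of_mem_erase hi)]
  rw [← add_sum_erase S _ hn, ← add_sum_erase S (fun i => g (q i)) hn, hrest,
    Function.update_self]
  abel

variable {A} in
theorem exists_joinShortest_eq (hA : A.Nonempty) :
    ∃ n ∈ A, (∀ j ∈ A, q n ≤ q j) ∧ joinShortest A q = Function.update q n (q n + 1) := by
  obtain ⟨hmem, hmin⟩ := (A.exists_min_image q hA).choose_spec
  exact ⟨_, hmem, hmin, dif_pos hA⟩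

theorem excess_joinShortest_le : excess H (joinShortest A q) ≤ excess H q + 1 := by
  rcases A.eq_empty_or_nonempty with rfl | hA
  · simp [joinShortest]
  · obtain ⟨n, -, -, hn⟩ := exists_joinShortest_eq q hA
    have h := sum_comp_update (mem_univ n) (fun i => i - H) q (q n + 1)
    rw [hn]
    simp only [excess]
    omega

theorem excess_batchFill_le : excess H (batchFill A k q) ≤ excess H q + k := by
  induction k generalizing q with
  | zero => rfl
  | succ k ih =>
    calc excess H (batchFill A k (joinShortest A q))
        ≤ excess H (joinShortest A q) + k := ih _
      _ ≤ excess H q + 1 + k := Nat.add_le_add_right (excess_joinShortest_le H A q) k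
      _ = excess H q + (k + 1) := by omega

variable {H k A q}

theorem excess_depart_of_lt {n : Fin N} (hn : H < q n) :
    excess H (depart q n) + 1 = excess H q := by
  have h := sum_comp_update (mem_univ n) (fun i => i - H) q (q n - 1)
  simp only [excess, depart]
  omega

theorem excess_depart_of_le {n : Fin N} (hn : q n ≤ H) : excess H (depart q n) = excess H q := by
  have h := sum_comp_update (mem_univ n) (fun i => i - H) q (q n - 1)
  simp only [excess, depart]
  omega

theorem excess_joinShortest_of_pos (hA : 0 < ∑ n ∈ A, (H - q n)) :
    excess H (joinShortest A q) = excess H q ∧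
      ∑ n ∈ A, (H - joinShortest A q n) + 1 = ∑ n ∈ A, (H - q n) := by
  obtain ⟨j, hj, hjpos⟩ := (sum_pos_iff_of_nonneg fun _ _ => Nat.zero_le _).1 hA
  obtain ⟨n, hnA, hmin, hn⟩ := exists_joinShortest_eq q ⟨j, hj⟩
  have hroom : q n < H := (hmin j hj).trans_lt (Nat.lt_of_sub_pos hjpos)
  have hfill := sum_comp_update hnA (fun i => H - i) q (q n + 1)
  have hover := sum_comp_update (mem_univ n) (fun i => i - H) q (q n + 1)
  rw [hn]
  simp only [excess]
  omega

theorem excess_batchFill_of_le (hk : k ≤ ∑ n ∈ A, (H - q n)) :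
    excess H (batchFill A k q) = excess H q := by
  induction k generalizing q with
  | zero => rfl
  | succ k ih =>
    obtain ⟨hexcess, hroom⟩ := excess_joinShortest_of_pos (Nat.zero_lt_of_lt hk)
    rw [batchFill, ih (by omega), hexcess]

end Excess

section Drift

variable {N b k m : ℕ} {lam : ℝ}

/-- The drift of a function `F` of the queue lengths: its expected rate of change under the dynamics
of `rate`, for servers with buffers of size `b`, load `lam`, jobs of `k` tasks and `m` sampled
queues per job. A job that does not fit into the buffers is dropped and contributes nothing. -/
noncomputable def drift {N : ℕ} (b k m : ℕ) (lam : ℝ) (F : (Fin N → ℕ) → ℝ) (q : Fin N → ℕ) :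
    ℝ :=
  ∑ n with 0 < q n, (F (depart q n) - F q) +
    N * lam / k * ((∑ A ∈ powersetCard m univ with ∀ n, batchFill A k q n ≤ b,
      (F (batchFill A k q) - F q)) / N.choose m)

theorem drift_add (F G : (Fin N → ℕ) → ℝ) (q : Fin N → ℕ) :
    drift b k m lam (fun q => F q + G q) q = drift b k m lam F q + drift b k m lam G q := by
  simp only [drift, add_sub_add_comm, sum_add_distrib]
  ring

theorem drift_const_mul (c : ℝ) (F : (Fin N → ℕ) → ℝ) (q : Fin N → ℕ) :
    drift b k m lam (fun q => c * F q) q = c * drift b k m lam F q := by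
  simp only [drift, ← mul_sub, ← mul_sum]
  ring

theorem depart_le (q : Fin N → ℕ) (n i : Fin N) : depart q n i ≤ q i := by
  rcases eq_or_ne i n with rfl | h
  · simp [depart]
  · simp [depart, h]

variable {p : State N b → ℝ} {F : (Fin N → ℕ) → ℝ}

theorem IsStationary.sum_drift_eq_zero (hp : IsStationary N b k m lam p)
    (hF : ∀ q : Fin N → ℕ, (∀ n, q n ≤ b) → F (toState b q).queues = F q) :
    ∑ s, p s * drift b k m lam F s.queues = 0 := by
  rw [← sum_mul_generator_eq_zero hp.balance fun s => F s.queues]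
  refine sum_congr rfl fun s _ => congrArg (p s * ·) ?_
  have hdepart : ∑ n with 0 < s.queues n, (F (depart s.queues n) - F s.queues) =
      ∑ n with 0 < s.queues n, (F (toState b (depart s.queues n)).queues - F s.queues) :=
    sum_congr rfl fun n _ => by
      rw [hF _ fun i => (depart_le _ _ _).trans (s.queues_le i)]
  have harrive : ∑ A ∈ powersetCard m univ with ∀ n, batchFill A k s.queues n ≤ b,
      (F (batchFill A k s.queues) - F s.queues) =
      ∑ A ∈ powersetCard m univ with ∀ n, batchFill A k s.queues n ≤ b,
        (F (toState b (batchFill A k s.queues)).queues - F s.queues) :=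
    sum_congr rfl fun A hA => by rw [hF _ (mem_filter.1 hA).2]
  simp only [drift, rate, add_mul, sum_add_distrib, mul_assoc, ← mul_sum, div_mul_eq_mul_div,
    ← sum_div, hdepart, harrive]
  rw [sum_card_fiber_mul, sum_card_fiber_mul]

theorem IsStationary.sum_mul_le (hp : IsStationary N b k m lam p) {κ c : ℝ}
    (hF : ∀ q : Fin N → ℕ, (∀ n, q n ≤ b) → F (toState b q).queues = F q)
    (hdrift : ∀ q, drift b k m lam F q ≤ -κ * F q + c) :
    κ * ∑ s, p s * F s.queues ≤ c := by
  have hmean : 0 ≤ -κ * ∑ s, p s * F s.queues + c := by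
    calc 0 = ∑ s, p s * drift b k m lam F s.queues := (hp.sum_drift_eq_zero hF).symm
      _ ≤ ∑ s, p s * (-κ * F s.queues + c) :=
          sum_le_sum fun s _ => mul_le_mul_of_nonneg_left (hdrift _) (hp.nonneg s)
      _ = -κ * ∑ s, p s * F s.queues + c := by
          simp only [mul_add, sum_add_distrib, ← sum_mul, hp.sum_eq_one, one_mul, mul_sum,
            mul_left_comm]
  linarith

end Drift

section Shortage

/-- The probability that a sample of `m` queues, drawn uniformly without replacement, has fewer
than `k` free positions up to level `H`. -/
noncomputable def shortage {N : ℕ} (H k m : ℕ) (q : Fin N → ℕ) : ℝ :=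
  #{A ∈ powersetCard m univ | ∑ n ∈ A, (H - q n) < k} / N.choose m

variable {N : ℕ} (H k m : ℕ) (q : Fin N → ℕ)

theorem shortage_nonneg : 0 ≤ shortage H k m q := by
  unfold shortage
  positivity

theorem shortage_le_one : shortage H k m q ≤ 1 := by
  refine div_le_one_of_le₀ ?_ (Nat.cast_nonneg _)
  exact_mod_cast (card_filter_le _ _).trans_eq (by simp)

variable {H k m q}

theorem shortage_le_exp (hm : m ≤ N) (hH : 0 < H)
    (hroom : (4 * k : ℝ) ≤ m * (deficit H q / N)) :
    shortage H k m q ≤ Real.exp (-(k / H)) := by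
  have hH' : (0 : ℝ) < H := mod_cast hH
  have hbound := card_filter_sum_le_le (S := (univ : Finset (Fin N)))
    (a := fun n => ((H - q n : ℕ) : ℝ) / H)
    (fun n _ => ⟨by positivity, div_le_one_of_le₀ (mod_cast Nat.sub_le _ _) hH'.le⟩) m (k / H)
  rw [shortage, div_le_iff₀ (mod_cast Nat.choose_pos hm)]
  calc (#{A ∈ powersetCard m univ | ∑ n ∈ A, (H - q n) < k} : ℝ)
      ≤ #{A ∈ powersetCard m univ | ∑ n ∈ A, ((H - q n : ℕ) : ℝ) / H ≤ k / H} := by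
        gcongr with A
        intro hA
        rw [← sum_div]
        gcongr
        exact_mod_cast hA.le
    _ ≤ N.choose m * Real.exp (k / H - m * (deficit H q / H / N) / 2) := by
        simpa [deficit, sum_div] using hbound
    _ ≤ N.choose m * Real.exp (-(k / H)) := by
        gcongr
        have hmean : 4 * (k / H : ℝ) ≤ m * (deficit H q / H / N) := by
          calc 4 * (k / H : ℝ) = 4 * k / H := by ring
            _ ≤ m * (deficit H q / N) / H := by gcongr
            _ = _ := by ring
        linarith
    _ = _ := mul_comm _ _

end Shortage

section ExpExcess

variable {N b k m H : ℕ} {lam τ : ℝ}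

theorem exp_le_one_add_add_sq {u : ℝ} (hu : |u| ≤ 1) : Real.exp u ≤ 1 + u + u ^ 2 := by
  linarith [(abs_le.1 (Real.abs_exp_sub_one_sub_id_le hu)).2]

theorem sum_exp_excess_depart_sub_le (hτ0 : 0 ≤ τ) (hτ1 : τ ≤ 1) (q : Fin N → ℕ) :
    ∑ n with 0 < q n, (Real.exp (τ * excess H (depart q n)) - Real.exp (τ * excess H q)) ≤
      -(Real.exp (τ * excess H q) * (τ * (#{n | H < q n} * (1 - τ)))) := by
  have hexp : Real.exp (-τ) - 1 ≤ -(τ * (1 - τ)) := by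
    linarith [exp_le_one_add_add_sq (u := -τ) (by rwa [abs_neg, abs_of_nonneg hτ0])]
  calc ∑ n with 0 < q n, (Real.exp (τ * excess H (depart q n)) - Real.exp (τ * excess H q))
      = ∑ n with 0 < q n, if H < q n then Real.exp (τ * excess H q) * (Real.exp (-τ) - 1)
          else 0 := by
        refine sum_congr rfl fun n _ => ?_
        split_ifs with hn
        · rw [← excess_depart_of_lt hn, mul_sub, ← Real.exp_add]
          push_cast
          ring_nf
        · rw [excess_depart_of_le (not_lt.1 hn), sub_self]
    _ = #{n | H < q n} * (Real.exp (τ * excess H q) * (Real.exp (-τ) - 1)) := by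
        rw [← sum_filter, filter_filter, sum_const, nsmul_eq_mul]
        congr! 4
        exact and_iff_right_of_imp Nat.zero_lt_of_lt
    _ ≤ #{n | H < q n} * (Real.exp (τ * excess H q) * -(τ * (1 - τ))) := by gcongr
    _ = _ := by ring

theorem sum_exp_excess_batchFill_sub_le (hτ : 0 ≤ τ) (hτk : τ * k ≤ 1) (q : Fin N → ℕ) :
    (∑ A ∈ powersetCard m univ with ∀ n, batchFill A k q n ≤ b,
      (Real.exp (τ * excess H (batchFill A k q)) - Real.exp (τ * excess H q))) / N.choose m ≤
      Real.exp (τ * excess H q) * (τ * k * (1 + τ * k) * shortage H k m q) := by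
  have hτk0 : 0 ≤ τ * k := by positivity
  set c := Real.exp (τ * excess H q) * (τ * k * (1 + τ * k)) with hc
  have hc0 : 0 ≤ c := hc ▸ by positivity
  have hjump : ∀ A, Real.exp (τ * excess H (batchFill A k q)) - Real.exp (τ * excess H q) ≤
      if ∑ n ∈ A, (H - q n) < k then c else 0 := by
    intro A
    split_ifs with hA
    · have hexcess : (excess H (batchFill A k q) : ℝ) ≤ excess H q + k :=
        mod_cast excess_batchFill_le H k A q
      calc Real.exp (τ * excess H (batchFill A k q)) - Real.exp (τ * excess H q)
          ≤ Real.exp (τ * (excess H q + k)) - Real.exp (τ * excess H q) := by gcongr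
        _ = Real.exp (τ * excess H q) * (Real.exp (τ * k) - 1) := by
            rw [mul_add, Real.exp_add]
            ring
        _ ≤ c := by
            rw [hc]
            gcongr
            linarith [exp_le_one_add_add_sq (u := τ * k) (by rwa [abs_of_nonneg hτk0])]
    · rw [excess_batchFill_of_le (not_lt.1 hA), sub_self]
  calc _ ≤ (∑ A ∈ powersetCard m (univ : Finset (Fin N)) with ∀ n, batchFill A k q n ≤ b,
        if ∑ n ∈ A, (H - q n) < k then c else 0) / N.choose m := by
        gcongr with A
        exact hjump A
    _ ≤ (∑ A ∈ powersetCard m (univ : Finset (Fin N)),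
        if ∑ n ∈ A, (H - q n) < k then c else 0) / N.choose m := by
        refine div_le_div_of_nonneg_right (sum_le_sum_of_subset_of_nonneg (filter_subset _ _)
          fun A _ _ => ?_) (Nat.cast_nonneg _)
        split_ifs
        exacts [hc0, le_rfl]
    _ = _ := by
        rw [← sum_filter, sum_const, nsmul_eq_mul, shortage, hc]
        ring

theorem drift_exp_excess_le (hlam : 0 ≤ lam) (hk : 0 < k) (hτ : 0 ≤ τ) (hτk : τ * k ≤ 1)
    (q : Fin N → ℕ) :
    drift b k m lam (fun q => Real.exp (τ * excess H q)) q ≤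
      Real.exp (τ * excess H q) *
        (τ * (N * lam * (1 + τ * k) * shortage H k m q - #{n | H < q n} * (1 - τ))) := by
  have hk' : (1 : ℝ) ≤ k := mod_cast hk
  have hτ1 : τ ≤ 1 := (le_mul_of_one_le_right hτ hk').trans hτk
  calc _ ≤ -(Real.exp (τ * excess H q) * (τ * (#{n | H < q n} * (1 - τ)))) +
        N * lam / k * (Real.exp (τ * excess H q) * (τ * k * (1 + τ * k) * shortage H k m q)) := by
        unfold drift
        gcongr
        · exact sum_exp_excess_depart_sub_le hτ hτ1 q
        · exact sum_exp_excess_batchFill_sub_le hτ hτk q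
    _ = _ := by
        field_simp
        ring

end ExpExcess

section Regimes

variable {N b k m H : ℕ} {ε τ : ℝ} {q : Fin N → ℕ}

theorem excess_eq_zero_of_card_eq_zero (h : #{n | H < q n} = 0) : excess H q = 0 :=
  sum_eq_zero fun _ hn => Nat.sub_eq_zero_of_le
    (not_lt.1 (filter_eq_empty_iff.1 (card_eq_zero.1 h) hn))

theorem drift_exp_excess_le_two_mul (hε0 : 0 ≤ ε) (hε1 : ε ≤ 1) (hk : 0 < k) (hτ : 0 ≤ τ)
    (hτk : τ * k ≤ 1) (q : Fin N → ℕ) :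
    drift b k m (1 - ε) (fun q => Real.exp (τ * excess H q)) q ≤
      2 * N * τ * Real.exp (τ * excess H q) := by
  have hk' : (1 : ℝ) ≤ k := mod_cast hk
  have hτ1 : τ ≤ 1 := (le_mul_of_one_le_right hτ hk').trans hτk
  have hrate : N * (1 - ε) * (1 + τ * k) * shortage H k m q - #{n | H < q n} * (1 - τ) ≤
      2 * N := by
    calc N * (1 - ε) * (1 + τ * k) * shortage H k m q - #{n | H < q n} * (1 - τ)
        ≤ N * 1 * (1 + 1) * 1 - #{n | H < q n} * (1 - 1) := by
          gcongr
          · exact shortage_nonneg H k m q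
          · linarith
          · exact shortage_le_one H k m q
      _ = 2 * N := by ring
  calc _ ≤ Real.exp (τ * excess H q) *
        (τ * (N * (1 - ε) * (1 + τ * k) * shortage H k m q - #{n | H < q n} * (1 - τ))) :=
        drift_exp_excess_le (sub_nonneg.2 hε1) hk hτ hτk q
    _ ≤ Real.exp (τ * excess H q) * (τ * (2 * N)) := by gcongr
    _ = _ := by ring

theorem drift_exp_excess_le_of_shortage_le (hε0 : 0 ≤ ε) (hε1 : ε ≤ 1) (hk : 0 < k) (hτ : 0 ≤ τ)
    (hτ2 : τ ≤ 1 / 2) (hτk : τ * k ≤ 1) (hshort : 8 * N * shortage H k m q ≤ 1) :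
    drift b k m (1 - ε) (fun q => Real.exp (τ * excess H q)) q ≤
      -(τ / 4) * Real.exp (τ * excess H q) + τ := by
  have hdrift := drift_exp_excess_le (b := b) (m := m) (H := H) (sub_nonneg.2 hε1) hk hτ hτk q
  have harrive : N * (1 - ε) * (1 + τ * k) * shortage H k m q ≤ 1 / 4 := by
    calc N * (1 - ε) * (1 + τ * k) * shortage H k m q
        ≤ N * 1 * (1 + 1) * shortage H k m q := by
          gcongr
          · exact shortage_nonneg H k m q
          · linarith
      _ ≤ 1 / 4 := by linarith
  rcases Nat.eq_zero_or_pos #{n | H < q n} with hnone | hsome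
  · rw [hnone, excess_eq_zero_of_card_eq_zero hnone] at hdrift
    rw [excess_eq_zero_of_card_eq_zero hnone]
    norm_num at hdrift ⊢
    linarith [mul_le_mul_of_nonneg_left harrive hτ]
  · have hdepart : 1 * (1 / 2) ≤ #{n | H < q n} * (1 - τ) := by
      gcongr
      · exact_mod_cast hsome
      · linarith
    calc _ ≤ _ := hdrift
      _ ≤ Real.exp (τ * excess H q) * (τ * (1 / 4 - 1 * (1 / 2))) := by gcongr
      _ ≤ _ := by linarith

theorem drift_exp_excess_zero_le_of_deficit_le (hε0 : 0 ≤ ε) (hε1 : ε ≤ 1) (hk : 0 < k)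
    (hH : 0 < H) (hτ : 0 ≤ τ) (hτk : τ * k ≤ ε / 32)
    (hdeficit : deficit H q ≤ 7 / 8 * (ε * H * N)) :
    drift b k m (1 - ε) (fun q => Real.exp (τ * excess 0 q)) q ≤
      -(τ * (N * ε) / 16) * Real.exp (τ * excess 0 q) := by
  have hk' : (1 : ℝ) ≤ k := mod_cast hk
  have hτ1 : τ ≤ ε / 32 := (le_mul_of_one_le_right hτ hk').trans hτk
  have hidle : (#{n | q n = 0} : ℝ) ≤ 7 / 8 * (ε * N) := by
    refine le_of_mul_le_mul_left ?_ (Nat.cast_pos.2 hH : (0 : ℝ) < H)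
    calc (H * #{n | q n = 0} : ℝ) ≤ deficit H q := mod_cast mul_card_idle_le_deficit H q
      _ ≤ 7 / 8 * (ε * H * N) := hdeficit
      _ = _ := by ring
  have hbusy : (#{n | q n = 0} : ℝ) + #{n | 0 < q n} = N := by
    have h := card_filter_add_card_filter_not (s := univ) fun n => q n = 0
    simp only [← Nat.pos_iff_ne_zero, card_fin] at h
    exact_mod_cast h
  have hlam : 0 ≤ 1 - ε := sub_nonneg.2 hε1
  have hbusyN : #{n | 0 < q n} * τ ≤ N * (ε / 32) := by
    gcongr
    exact (card_filter_le _ _).trans_eq (card_fin N)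
  have harrive : N * (1 - ε) * (1 + τ * k) * shortage 0 k m q ≤ N * (1 - ε) + N * (ε / 32) := by
    calc N * (1 - ε) * (1 + τ * k) * shortage 0 k m q ≤ N * (1 - ε) * (1 + τ * k) * 1 := by
          gcongr
          exact shortage_le_one 0 k m q
      _ = N * (1 - ε) + N * ((1 - ε) * (τ * k)) := by ring
      _ ≤ N * (1 - ε) + N * (1 * (ε / 32)) := by
          gcongr
          linarith
      _ = _ := by ring
  calc _ ≤ Real.exp (τ * excess 0 q) *
        (τ * (N * (1 - ε) * (1 + τ * k) * shortage 0 k m q - #{n | 0 < q n} * (1 - τ))) :=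
        drift_exp_excess_le hlam hk hτ (by linarith) q
    _ ≤ Real.exp (τ * excess 0 q) * (τ * (-(N * ε) / 16)) := by
        gcongr
        linarith
    _ = _ := by ring

end Regimes

section Lyapunov

variable {N b k m H : ℕ} {ε τ : ℝ} {q : Fin N → ℕ}

/-- The Lyapunov function: the exponential of the excess above level `H`, plus the exponential of
the number of tasks. The normalization makes the two summands equal when the deficit is
`3 / 4 * (ε * H * N)`. -/
noncomputable def lyapunov {N : ℕ} (τ ε : ℝ) (H : ℕ) (q : Fin N → ℕ) : ℝ :=
  Real.exp (τ * excess H q) +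
    Real.exp (-(τ * (H * N - 3 / 4 * (ε * H * N)))) * Real.exp (τ * excess 0 q)

theorem lyapunov_toState (hq : ∀ n, q n ≤ b) :
    lyapunov τ ε H (toState b q).queues = lyapunov τ ε H q := by
  simp only [lyapunov, excess_toState _ hq]

theorem exp_mul_exp_excess_zero :
    Real.exp (-(τ * (H * N - 3 / 4 * (ε * H * N)))) * Real.exp (τ * excess 0 q) =
      Real.exp (τ * excess H q) * Real.exp (τ * (3 / 4 * (ε * H * N) - deficit H q)) := by
  have h : (excess 0 q + deficit H q : ℝ) = excess H q + N * H :=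
    mod_cast excess_zero_add_deficit H q
  rw [← Real.exp_add, ← Real.exp_add]
  congr 1
  linear_combination τ * h

theorem exp_excess_le_of_deficit_le (hτ : 0 ≤ τ) (hdeficit : deficit H q ≤ 5 / 8 * (ε * H * N)) :
    Real.exp (τ * excess H q) ≤ Real.exp (-(τ * (ε * H * N) / 8)) *
      (Real.exp (-(τ * (H * N - 3 / 4 * (ε * H * N)))) * Real.exp (τ * excess 0 q)) := by
  rw [exp_mul_exp_excess_zero, ← Real.exp_add, ← Real.exp_add]
  gcongr
  linarith [mul_le_mul_of_nonneg_left hdeficit hτ]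

theorem exp_mul_exp_excess_zero_le_of_le_deficit (hτ : 0 ≤ τ)
    (hdeficit : 7 / 8 * (ε * H * N) ≤ deficit H q) :
    Real.exp (-(τ * (H * N - 3 / 4 * (ε * H * N)))) * Real.exp (τ * excess 0 q) ≤
      Real.exp (-(τ * (ε * H * N) / 8)) * Real.exp (τ * excess H q) := by
  rw [exp_mul_exp_excess_zero, mul_comm, ← Real.exp_add, ← Real.exp_add]
  gcongr
  linarith [mul_le_mul_of_nonneg_left hdeficit hτ]

theorem drift_lyapunov (lam : ℝ) :
    drift b k m lam (lyapunov τ ε H) q =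
      drift b k m lam (fun q => Real.exp (τ * excess H q)) q +
        Real.exp (-(τ * (H * N - 3 / 4 * (ε * H * N)))) *
          drift b k m lam (fun q => Real.exp (τ * excess 0 q)) q := by
  rw [← drift_const_mul, ← drift_add]
  rfl

theorem drift_exp_excess_le_of_le_deficit (hε0 : 0 ≤ ε) (hε1 : ε ≤ 1) (hk : 0 < k) (hH : 0 < H)
    (hτ : 0 ≤ τ) (hτk : τ * k ≤ 1 / 2) (hm : m ≤ N) (hmk : 4 * k ≤ m * (5 / 8 * (ε * H)))
    (hkH : 8 * N * Real.exp (-(k / H)) ≤ 1) (hdeficit : 5 / 8 * (ε * H * N) ≤ deficit H q) :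
    drift b k m (1 - ε) (fun q => Real.exp (τ * excess H q)) q ≤
      -(τ / 4) * Real.exp (τ * excess H q) + τ := by
  have hk' : (1 : ℝ) ≤ k := mod_cast hk
  refine drift_exp_excess_le_of_shortage_le hε0 hε1 hk hτ
    ((le_mul_of_one_le_right hτ hk').trans hτk) (by linarith) ?_
  rcases N.eq_zero_or_pos with rfl | hN
  · simp
  have hN' : (0 : ℝ) < N := mod_cast hN
  refine le_trans ?_ hkH
  gcongr
  refine shortage_le_exp hm hH (hmk.trans ?_)
  gcongr
  rw [le_div_iff₀ hN']
  linarith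

theorem drift_lyapunov_le_of_deficit_le (hε0 : 0 ≤ ε) (hε1 : ε ≤ 1) (hk : 0 < k) (hH : 0 < H)
    (hτ : 0 ≤ τ) (hτk : τ * k ≤ ε / 32) (hNε : 8 ≤ N * ε)
    (hρ : 64 * N * Real.exp (-(τ * (ε * H * N) / 8)) ≤ 1)
    (hdeficit : deficit H q ≤ 5 / 8 * (ε * H * N)) :
    drift b k m (1 - ε) (lyapunov τ ε H) q ≤ -(τ / 8) * lyapunov τ ε H q := by
  have hN : (8 : ℝ) ≤ N := hNε.trans (mul_le_of_le_one_right N.cast_nonneg hε1)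
  have hUV := exp_excess_le_of_deficit_le hτ hdeficit
  have hdriftU := drift_exp_excess_le_two_mul (b := b) (m := m) (H := H) hε0 hε1 hk hτ
    (by linarith) q
  have hdriftV := drift_exp_excess_zero_le_of_deficit_le (b := b) (m := m) hε0 hε1 hk hH hτ hτk
    (hdeficit.trans (by gcongr; norm_num))
  rw [drift_lyapunov, lyapunov]
  set c := Real.exp (-(τ * (H * N - 3 / 4 * (ε * H * N))))
  set U := Real.exp (τ * excess H q)
  set V := Real.exp (τ * excess 0 q)
  set ρ := Real.exp (-(τ * (ε * H * N) / 8))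
  have hρU : 64 * N * U ≤ c * V := by
    calc 64 * N * U ≤ 64 * N * (ρ * (c * V)) := by gcongr
      _ = 64 * N * ρ * (c * V) := by ring
      _ ≤ c * V := mul_le_of_le_one_left (by positivity) hρ
  calc _ ≤ 2 * N * τ * U + c * (-(τ * (N * ε) / 16) * V) := by gcongr
    _ = τ * (64 * N * U) / 32 - τ * (N * ε) / 16 * (c * V) := by ring
    _ ≤ τ * (c * V) / 32 - τ * 8 / 16 * (c * V) := by gcongr
    _ ≤ -(τ / 8) * (U + c * V) := by
      have hUcV : U ≤ c * V := (le_mul_of_one_le_left (by positivity) (by linarith)).trans hρU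
      linarith [mul_le_mul_of_nonneg_left hUcV hτ, mul_nonneg hτ (by positivity : 0 ≤ c * V)]

theorem drift_lyapunov_le_of_le_deficit (hε0 : 0 ≤ ε) (hε1 : ε ≤ 1) (hk : 0 < k) (hH : 0 < H)
    (hτ : 0 ≤ τ) (hτk : τ * k ≤ 1 / 2) (hN : 1 ≤ N) (hm : m ≤ N)
    (hmk : 4 * k ≤ m * (5 / 8 * (ε * H)))
    (hkH : 8 * N * Real.exp (-(k / H)) ≤ 1)
    (hρ : 64 * N * Real.exp (-(τ * (ε * H * N) / 8)) ≤ 1)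
    (hdeficit : 7 / 8 * (ε * H * N) ≤ deficit H q) :
    drift b k m (1 - ε) (lyapunov τ ε H) q ≤ -(τ / 8) * lyapunov τ ε H q + τ := by
  have hN' : (1 : ℝ) ≤ N := mod_cast hN
  have hVU := exp_mul_exp_excess_zero_le_of_le_deficit hτ hdeficit
  have hdriftU := drift_exp_excess_le_of_le_deficit (b := b) hε0 hε1 hk hH hτ hτk hm hmk hkH
    (le_trans (by gcongr; norm_num) hdeficit)
  have hdriftV := drift_exp_excess_le_two_mul (b := b) (m := m) (H := 0) hε0 hε1 hk hτ
    (by linarith) q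
  rw [drift_lyapunov, lyapunov]
  set c := Real.exp (-(τ * (H * N - 3 / 4 * (ε * H * N))))
  set U := Real.exp (τ * excess H q)
  set V := Real.exp (τ * excess 0 q)
  set ρ := Real.exp (-(τ * (ε * H * N) / 8))
  have hρV : 64 * N * (c * V) ≤ U := by
    calc 64 * N * (c * V) ≤ 64 * N * (ρ * U) := by gcongr
      _ = 64 * N * ρ * U := by ring
      _ ≤ U := mul_le_of_le_one_left (by positivity) hρ
  calc _ ≤ -(τ / 4) * U + τ + c * (2 * N * τ * V) := by gcongr
    _ = -(τ / 4) * U + τ + τ * (64 * N * (c * V)) / 32 := by ring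
    _ ≤ -(τ / 4) * U + τ + τ * U / 32 := by gcongr
    _ ≤ -(τ / 8) * (U + c * V) + τ := by
      have hcVU : 64 * 1 * (c * V) ≤ U := le_trans (by gcongr) hρV
      linarith [mul_le_mul_of_nonneg_left hcVU hτ, mul_nonneg hτ (by positivity : 0 ≤ U)]

theorem drift_lyapunov_le (hε0 : 0 ≤ ε) (hε1 : ε ≤ 1) (hk : 0 < k) (hH : 0 < H)
    (hτ : 0 ≤ τ) (hτk : τ * k ≤ ε / 32) (hNε : 8 ≤ N * ε) (hm : m ≤ N)
    (hmk : 4 * k ≤ m * (5 / 8 * (ε * H)))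
    (hkH : 8 * N * Real.exp (-(k / H)) ≤ 1)
    (hρ : 64 * N * Real.exp (-(τ * (ε * H * N) / 8)) ≤ 1) (q : Fin N → ℕ) :
    drift b k m (1 - ε) (lyapunov τ ε H) q ≤ -(τ / 8) * lyapunov τ ε H q + τ := by
  have hτk' : τ * k ≤ 1 / 2 := by linarith
  have hN : 1 ≤ N := Nat.pos_of_ne_zero fun h => by norm_num [h] at hNε
  -- A small deficit makes the first summand of `lyapunov` negligible, a large one the second; in
  -- between both have negative drift.
  rcases le_total (deficit H q : ℝ) (5 / 8 * (ε * H * N)) with hsmall | hge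
  · linarith [drift_lyapunov_le_of_deficit_le (b := b) (m := m) hε0 hε1 hk hH hτ hτk hNε hρ hsmall]
  rcases le_total (deficit H q : ℝ) (7 / 8 * (ε * H * N)) with hle | hlarge
  · have hdriftU := drift_exp_excess_le_of_le_deficit (b := b) hε0 hε1 hk hH hτ hτk' hm hmk hkH hge
    have hdriftV :=
      drift_exp_excess_zero_le_of_deficit_le (b := b) (m := m) hε0 hε1 hk hH hτ hτk hle
    rw [drift_lyapunov, lyapunov]
    set c := Real.exp (-(τ * (H * N - 3 / 4 * (ε * H * N))))
    set U := Real.exp (τ * excess H q)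
    set V := Real.exp (τ * excess 0 q)
    calc _ ≤ -(τ / 4) * U + τ + c * (-(τ * (N * ε) / 16) * V) := by gcongr
      _ = -(τ / 4) * U + τ - τ * (N * ε) / 16 * (c * V) := by ring
      _ ≤ -(τ / 4) * U + τ - τ * 8 / 16 * (c * V) := by gcongr
      _ ≤ -(τ / 8) * (U + c * V) + τ := by
        linarith [mul_nonneg hτ (by positivity : 0 ≤ U), mul_nonneg hτ (by positivity : 0 ≤ c * V)]
  · exact drift_lyapunov_le_of_le_deficit hε0 hε1 hk hH hτ hτk' hN hm hmk hkH hρ hlarge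

theorem IsStationary.sum_mul_lyapunov_le {p : State N b → ℝ} (hp : IsStationary N b k m (1 - ε) p)
    (hε0 : 0 ≤ ε) (hε1 : ε ≤ 1) (hk : 0 < k) (hH : 0 < H) (hτ : 0 < τ) (hτk : τ * k ≤ ε / 32)
    (hNε : 8 ≤ N * ε) (hm : m ≤ N) (hmk : 4 * k ≤ m * (5 / 8 * (ε * H)))
    (hkH : 8 * N * Real.exp (-(k / H)) ≤ 1)
    (hρ : 64 * N * Real.exp (-(τ * (ε * H * N) / 8)) ≤ 1) :
    ∑ s, p s * lyapunov τ ε H s.queues ≤ 8 := by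
  have h := hp.sum_mul_le (fun q hq => lyapunov_toState hq)
    (drift_lyapunov_le hε0 hε1 hk hH hτ.le hτk hNε hm hmk hkH hρ)
  refine le_of_mul_le_mul_left ?_ (by positivity : 0 < τ / 8)
  linarith

theorem max_total_sub_le (hN : 0 < N) (hτ : 0 < τ) (s : State N b) :
    max (s.total - H * (1 - 1 / 2 * ε)) 0 ≤
      Real.exp (-(τ * (ε * H * N) / 4)) / (τ * N) * lyapunov τ ε H s.queues := by
  have hN' : (0 : ℝ) < N := mod_cast hN
  have hlyap : Real.exp (-(τ * (H * N - 3 / 4 * (ε * H * N)))) * Real.exp (τ * excess 0 s.queues) ≤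
      lyapunov τ ε H s.queues := le_add_of_nonneg_left (Real.exp_nonneg _)
  have htotal : N * s.total = excess 0 s.queues := by
    rw [s.total_eq, mul_div_cancel₀ _ hN'.ne']
    rfl
  refine max_le ?_ (mul_nonneg (by positivity) ((by positivity : (0 : ℝ) ≤ _).trans hlyap))
  rw [div_mul_eq_mul_div (Real.exp _), le_div_iff₀ (by positivity)]
  set x := s.total - H * (1 - 1 / 2 * ε) with hx
  calc x * (τ * N) ≤ Real.exp (x * (τ * N)) := (lt_add_one _).le.trans (Real.add_one_le_exp _)
    _ = Real.exp (-(τ * (ε * H * N) / 4)) * (Real.exp (-(τ * (H * N - 3 / 4 * (ε * H * N)))) *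
          Real.exp (τ * excess 0 s.queues)) := by
        rw [← Real.exp_add, ← Real.exp_add, ← htotal, hx]
        ring_nf
    _ ≤ _ := by gcongr

theorem IsStationary.sum_max_total_le {p : State N b → ℝ} (hp : IsStationary N b k m (1 - ε) p)
    (hε0 : 0 ≤ ε) (hε1 : ε ≤ 1) (hk : 0 < k) (hH : 0 < H) (hτ : 0 < τ) (hτk : τ * k ≤ ε / 32)
    (hNε : 8 ≤ N * ε) (hm : m ≤ N) (hmk : 4 * k ≤ m * (5 / 8 * (ε * H)))
    (hkH : 8 * N * Real.exp (-(k / H)) ≤ 1)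
    (hρ : 64 * N * Real.exp (-(τ * (ε * H * N) / 8)) ≤ 1) :
    ∑ s, p s * max (s.total - H * (1 - 1 / 2 * ε)) 0 ≤
      8 / (τ * N) * Real.exp (-(τ * (ε * H * N) / 4)) := by
  have hN : 0 < N := Nat.pos_of_ne_zero fun h => by norm_num [h] at hNε
  calc _ ≤ ∑ s, p s * (Real.exp (-(τ * (ε * H * N) / 4)) / (τ * N) * lyapunov τ ε H s.queues) :=
        sum_le_sum fun s _ => mul_le_mul_of_nonneg_left (max_total_sub_le hN hτ s) (hp.nonneg s)
    _ = Real.exp (-(τ * (ε * H * N) / 4)) / (τ * N) * ∑ s, p s * lyapunov τ ε H s.queues := by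
        simp only [mul_sum, mul_left_comm]
    _ ≤ Real.exp (-(τ * (ε * H * N) / 4)) / (τ * N) * 8 := by
        gcongr
        exact hp.sum_mul_lyapunov_le hε0 hε1 hk hH hτ hτk hNε hm hmk hkH hρ
    _ = _ := by ring

end Lyapunov

section Parameters

theorem four_mul_le_floor_mul {k : ℕ} {ε h d : ℝ} (hε0 : 0 < ε) (hε1 : ε ≤ 1) (hh : 10 ≤ h)
    (hkh : 2 * h ≤ k) (hd : 8 / (ε * h) ≤ d) :
    4 * k ≤ ⌊k * d⌋₊ * (5 / 8 * (ε * ⌊h⌋₊)) := by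
  have hh0 : 0 < h := by linarith
  have hfloor : 9 / 10 * h ≤ ⌊h⌋₊ := by linarith [Nat.sub_one_lt_floor h]
  have hεh : ε * h ≤ k / 2 := by linarith [mul_le_of_le_one_left hh0.le hε1]
  have hsample : k * (8 / (ε * h)) - 1 ≤ ⌊k * d⌋₊ := by
    calc k * (8 / (ε * h)) - 1 ≤ k * d - 1 := by gcongr
      _ ≤ ⌊k * d⌋₊ := (Nat.sub_one_lt_floor _).le
  calc (4 * k : ℝ) ≤ 9 / 2 * k - 9 / 16 * (ε * h) := by linarith
    _ = (k * (8 / (ε * h)) - 1) * (5 / 8 * (ε * (9 / 10 * h))) := by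
        field_simp
        ring
    _ ≤ ⌊k * d⌋₊ * (5 / 8 * (ε * ⌊h⌋₊)) := by gcongr

theorem exp_neg_nat_mul_log {x : ℝ} (hx : 0 < x) (n : ℕ) :
    Real.exp (-(n * Real.log x)) = 1 / x ^ n := by
  rw [Real.exp_neg, Real.exp_nat_mul, Real.exp_log hx, one_div]

variable {N : ℕ} {ε : ℝ}

theorem exp_neg_log_div_sqrt_mul_le {k H r : ℕ} (hN : 0 < N) (hkH : 8 ≤ k * Real.log N * H)
    (hkε : (r + 2) * (k * Real.log N) ≤ ε * √N) :
    Real.exp (-(Real.log N / √N * (ε * H * N) / 8)) ≤ 1 / N ^ (r + 2) := by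
  have hN' : (0 : ℝ) < N := mod_cast hN
  have := Real.log_natCast_nonneg N
  rw [← exp_neg_nat_mul_log hN', Real.exp_le_exp, neg_le_neg_iff, Nat.cast_add, Nat.cast_two]
  calc (r + 2) * Real.log N = (r + 2) * Real.log N * 8 / 8 := by ring
    _ ≤ (r + 2) * Real.log N * (k * Real.log N * H) / 8 := by gcongr
    _ = (r + 2) * (k * Real.log N) * (Real.log N * H) / 8 := by ring
    _ ≤ ε * √N * (Real.log N * H) / 8 := by gcongr
    _ = Real.log N * (N / √N) * (ε * H) / 8 := by rw [Real.div_sqrt]; ring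
    _ = Real.log N / √N * (ε * H * N) / 8 := by ring

theorem eight_mul_mul_exp_neg_div_floor_le_one {h x : ℝ} (hN : 8 ≤ N) (hh : 1 ≤ h)
    (hx : 2 * (h * Real.log N) ≤ x) : 8 * N * Real.exp (-(x / ⌊h⌋₊)) ≤ 1 := by
  have hN' : (8 : ℝ) ≤ N := mod_cast hN
  have hH : (0 : ℝ) < ⌊h⌋₊ := mod_cast Nat.floor_pos.2 hh
  have := Real.log_natCast_nonneg N
  have hexponent : (2 : ℕ) * Real.log N ≤ x / ⌊h⌋₊ := by
    rw [le_div_iff₀ hH]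
    calc (2 : ℕ) * Real.log N * ⌊h⌋₊ = 2 * (⌊h⌋₊ * Real.log N) := by push_cast; ring
      _ ≤ 2 * (h * Real.log N) := by gcongr; exact Nat.floor_le (by linarith)
      _ ≤ x := hx
  calc 8 * N * Real.exp (-(x / ⌊h⌋₊)) ≤ N * N * Real.exp (-((2 : ℕ) * Real.log N)) := by gcongr
    _ = 1 := by rw [exp_neg_nat_mul_log (by linarith)]; field_simp

theorem eight_le_log_div_sqrt_mul (hN : 64 ≤ N) : 8 ≤ Real.log N / √N * N := by
  have hN' : (64 : ℝ) ≤ N := mod_cast hN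
  have hL : 1 ≤ Real.log N :=
    (Real.le_log_iff_exp_le (by linarith)).2 (by linarith [Real.exp_one_lt_three])
  have hsqrt : 8 ≤ √(N : ℝ) := Real.le_sqrt_of_sq_le (by linarith)
  rw [div_mul_eq_mul_div, mul_div_assoc, Real.div_sqrt]
  nlinarith

theorem mul_le_one_of_le_one_div_pow {x : ℝ} {r : ℕ} (hN : 64 ≤ N) (hx : x ≤ 1 / N ^ (r + 2)) :
    64 * N * x ≤ 1 := by
  have hN' : (64 : ℝ) ≤ N := mod_cast hN
  calc 64 * N * x ≤ 64 * N * (1 / N ^ (r + 2)) := by gcongr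
    _ ≤ N * N * (1 / N ^ (r + 2)) := by gcongr
    _ = 1 / N ^ r := by
        rw [pow_add, ← sq, mul_one_div, div_mul_cancel_right₀ (by positivity), one_div]
    _ ≤ 1 := div_le_one_of_le₀ (one_le_pow₀ (by linarith)) (by positivity)

theorem IsStationary.sum_max_total_sub_anti {b k m : ℕ} {lam x y : ℝ} {p : State N b → ℝ}
    (hp : IsStationary N b k m lam p) (hxy : x ≤ y) :
    ∑ s, p s * max (s.total - y) 0 ≤ ∑ s, p s * max (s.total - x) 0 := by
  gcongr with s
  exact hp.nonneg s

theorem IsStationary.sum_max_total_le_one_div_pow {b k r : ℕ} {h d : ℝ} {p : State N b → ℝ}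
    (hp : IsStationary N b k ⌊k * d⌋₊ (1 - ε) p) (hN : 64 ≤ N) (hε0 : 0 < ε) (hε1 : ε ≤ 1)
    (hh : 10 ≤ h) (hkh : 2 * (h * Real.log N) ≤ k)
    (hkε : (32 + r) * (k * Real.log N) ≤ ε * √N) (hd : 8 / (ε * h) ≤ d) (hdN : ⌊k * d⌋₊ ≤ N) :
    ∑ s, p s * max (s.total - h * (1 - 1 / 2 * ε)) 0 ≤ 1 / N ^ r := by
  have hN' : (64 : ℝ) ≤ N := mod_cast hN
  have hN0 : (0 : ℝ) < N := by linarith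
  have hL : 1 ≤ Real.log N := (Real.le_log_iff_exp_le hN0).2 (by linarith [Real.exp_one_lt_three])
  have hsqrt : 8 ≤ √(N : ℝ) := Real.le_sqrt_of_sq_le (by linarith)
  have hk2h : 2 * h ≤ k := le_trans (by nlinarith) hkh
  have hk : 20 ≤ k := by exact_mod_cast (by linarith : (20 : ℝ) ≤ k)
  have hkL : 20 ≤ k * Real.log N := by nlinarith
  have hH : 1 ≤ ⌊h⌋₊ := Nat.floor_pos.2 (by linarith)
  have hτk : Real.log N / √N * k ≤ ε / 32 := by
    rw [div_mul_eq_mul_div, div_le_iff₀ (by linarith)]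
    nlinarith
  have hNε : 8 ≤ N * ε := by
    have hε : 1 ≤ ε * √N := by nlinarith
    calc 8 ≤ √N * (ε * √N) := by nlinarith
      _ = N * ε := by rw [mul_left_comm, Real.mul_self_sqrt hN0.le, mul_comm]
  have hρ : Real.exp (-(Real.log N / √N * (ε * ⌊h⌋₊ * N) / 8)) ≤ 1 / N ^ (r + 2) :=
    exp_neg_log_div_sqrt_mul_le (k := k) (by lia)
      (by nlinarith [(mod_cast hH : (1 : ℝ) ≤ ⌊h⌋₊)]) (by nlinarith)
  have hbound := hp.sum_max_total_le hε0.le hε1 (by lia) hH (by positivity) hτk hNε hdN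
    (four_mul_le_floor_mul hε0 hε1 hh hk2h hd)
    (eight_mul_mul_exp_neg_div_floor_le_one (by lia) (by linarith) hkh)
    (mul_le_one_of_le_one_div_pow hN hρ)
  calc _ ≤ ∑ s, p s * max (s.total - ⌊h⌋₊ * (1 - 1 / 2 * ε)) 0 := by
        refine hp.sum_max_total_sub_anti ?_
        gcongr
        · linarith
        · exact Nat.floor_le (by linarith)
    _ ≤ 8 / (Real.log N / √N * N) * Real.exp (-(Real.log N / √N * (ε * ⌊h⌋₊ * N) / 4)) := hbound
    _ ≤ 1 * Real.exp (-(Real.log N / √N * (ε * ⌊h⌋₊ * N) / 8)) := by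
        gcongr
        · exact div_le_one_of_le₀ (eight_le_log_div_sqrt_mul hN) (by positivity)
        · norm_num
    _ ≤ 1 / N ^ (r + 2) := by rwa [one_mul]
    _ ≤ 1 / N ^ r := by gcongr <;> [linarith; lia]

end Parameters

section Asymptotics

theorem eventually_mul_rpow_neg_mem_Ioc {α β : ℝ} (hα : 0 ≤ α) (hβ : 0 < β) (hβ' : β ≤ 1) :
    ∀ᶠ N : ℕ in atTop, β * (N : ℝ) ^ (-α) ∈ Set.Ioc 0 1 := by
  filter_upwards [eventually_ge_atTop 1] with N hN
  have hN' : (1 : ℝ) ≤ N := mod_cast hN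
  exact ⟨by positivity, mul_le_one₀ hβ' (by positivity)
    (Real.rpow_le_one_of_one_le_of_nonpos hN' (neg_nonpos.2 hα))⟩

theorem isLittleO_mul_log {k : ℕ → ℝ} {α β : ℝ} (hβ : β ≠ 0)
    (hk : k =o[atTop] fun N : ℕ => (N : ℝ) ^ (1 / 2 - α) / Real.log N ^ 2) :
    (fun N => k N * Real.log N) =o[atTop] fun N : ℕ => β * (N : ℝ) ^ (-α) * √N := by
  have hscale : (fun N : ℕ => (N : ℝ) ^ (1 / 2 - α) / Real.log N ^ 2 * Real.log N)
      =O[atTop] fun N : ℕ => β * (N : ℝ) ^ (-α) * √N := by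
    refine IsBigO.of_bound ‖β‖⁻¹ ?_
    filter_upwards
      [(Real.tendsto_log_atTop.comp tendsto_natCast_atTop_atTop).eventually_ge_atTop 1,
      eventually_gt_atTop 0] with N (hL : 1 ≤ Real.log N) hN
    have hN' : (0 : ℝ) < N := mod_cast hN
    calc ‖(N : ℝ) ^ (1 / 2 - α) / Real.log N ^ 2 * Real.log N‖
        = N ^ (1 / 2 - α) / Real.log N := by
          rw [Real.norm_of_nonneg (by positivity)]
          field_simp
      _ ≤ (N : ℝ) ^ (1 / 2 - α) := div_le_self (by positivity) hL
      _ = N ^ (-α) * √N := by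
          rw [Real.sqrt_eq_rpow, ← Real.rpow_add hN', neg_add_eq_sub]
      _ = ‖β‖⁻¹ * ‖β * (N : ℝ) ^ (-α) * √N‖ := by
          rw [mul_assoc β, norm_mul, inv_mul_cancel_left₀ (norm_ne_zero_iff.2 hβ),
            Real.norm_of_nonneg (by positivity)]
  exact (hk.mul_isBigO (isBigO_refl _ _)).trans_isBigO hscale

theorem isLittleO_mul_of_isLittleO_log {ι : Type*} {l : Filter ι} {h x k : ι → ℝ}
    (hh : h =o[l] fun i => Real.log (k i)) (hx : x =O[l] fun i => k i / Real.log (k i)) :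
    (fun i => h i * x i) =o[l] k := by
  refine (hh.mul_isBigO hx).trans_isBigO (isBigO_of_le _ fun i => ?_)
  rcases eq_or_ne (Real.log (k i)) 0 with h0 | h0
  · simp [h0]
  · rw [mul_div_cancel₀ _ h0]

theorem one_div_le_five_div_sqrt_mul_log {x : ℝ} (hx : 1 < x) : 1 / x ≤ 5 / (√x * Real.log x) := by
  have hx0 : 0 < x := by linarith
  have hlog : Real.log x ≤ 2 * √x := by
    linarith [Real.log_sqrt hx0.le, Real.log_le_self (Real.sqrt_nonneg x)]
  have hlog0 : 0 < Real.log x := Real.log_pos hx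
  rw [div_le_div_iff₀ hx0 (by positivity)]
  calc 1 * (√x * Real.log x) ≤ 1 * (√x * (2 * √x)) := by gcongr
    _ = 2 * x := by rw [mul_left_comm √x, Real.mul_self_sqrt hx0.le, one_mul]
    _ ≤ 5 * x := by gcongr; norm_num

end Asymptotics

end BatchFilling

theorem theorem1_general (b k : ℕ → ℕ) (ε h d : ℕ → ℝ) (hε : ∀ᶠ N in atTop, ε N ∈ Set.Ioc 0 1)
    (hk : (fun N : ℕ => k N * Real.log N) =o[atTop] fun N : ℕ => ε N * √N)
    (hkh : (fun N : ℕ => h N * Real.log N) =o[atTop] fun N => (k N : ℝ))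
    (hh : ∀ᶠ N in atTop, 10 ≤ h N) (hd : ∀ᶠ N in atTop, 8 / (ε N * h N) ≤ d N)
    (hdN : ∀ᶠ N in atTop, ⌊(k N : ℝ) * d N⌋₊ ≤ N) (r : ℕ) :
    ∀ᶠ N in atTop, ∀ p : BatchFilling.State N (b N) → ℝ,
      BatchFilling.IsStationary N (b N) (k N) ⌊(k N : ℝ) * d N⌋₊ (1 - ε N) p →
      ∑ s, p s * max (s.total - h N * (1 - 1 / 2 * ε N)) 0 ≤ 1 / (N : ℝ) ^ r := by
  filter_upwards [hε, hk.bound (by positivity : (0 : ℝ) < 1 / (32 + r)),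
    hkh.bound (by norm_num : (0 : ℝ) < 1 / 2), hh, hd, hdN, eventually_ge_atTop 64]
    with N hε hk hkh hh hd hdN hN p hp
  have hL : 0 ≤ Real.log N := Real.log_natCast_nonneg N
  rw [Real.norm_of_nonneg (by positivity), Real.norm_of_nonneg (by have := hε.1; positivity),
    one_div_mul_eq_div, le_div_iff₀' (by positivity)] at hk
  rw [Real.norm_of_nonneg (by positivity), Real.norm_of_nonneg (by positivity),
    one_div_mul_eq_div, le_div_iff₀' two_pos] at hkh
  exact hp.sum_max_total_le_one_div_pow hN hε.1 hε.2 hh hkh hk hd hdN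

theorem theorem1 (α β : ℝ) (hα : 0 < α) (hα' : α < 1 / 2) (hβ : 0 < β) (hβ' : β ≤ 1)
    (k : ℕ → ℕ) (h d : ℕ → ℝ)
    (hk : (fun N : ℕ => (k N : ℝ)) =o[atTop]
      fun N : ℕ => (N : ℝ) ^ (1 / 2 - α) / Real.log N ^ 2)
    (hk' : (fun N : ℕ => Real.log N) =O[atTop] fun N : ℕ => (k N : ℝ) / Real.log (k N))
    (hh : h =o[atTop] fun N : ℕ => Real.log (k N))
    (hh' : Tendsto h atTop atTop)
    (hd : ∀ᶠ N in atTop, 8 / ((1 - BatchFilling.load α β N) * h N) ≤ d N)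
    (hdN : ∀ᶠ N in atTop, ⌊(k N : ℝ) * d N⌋₊ ≤ N) :
    ∀ᶠ N in atTop, ∀ p : BatchFilling.State N (BatchFilling.bufferSize α N (k N)) → ℝ,
      BatchFilling.IsStationary N (BatchFilling.bufferSize α N (k N)) (k N)
        ⌊(k N : ℝ) * d N⌋₊ (BatchFilling.load α β N) p →
      ∑ s, p s * max (s.total - h N * (1 - 1 / 2 * β * (N : ℝ) ^ (-α))) 0
        ≤ 5 / (√(N : ℝ) * Real.log N) := by
  have hbound := theorem1_general (fun N => BatchFilling.bufferSize α N (k N)) k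
    (fun N => β * (N : ℝ) ^ (-α)) h d
    (BatchFilling.eventually_mul_rpow_neg_mem_Ioc hα.le hβ hβ')
    (BatchFilling.isLittleO_mul_log hβ.ne' hk)
    (BatchFilling.isLittleO_mul_of_isLittleO_log hh hk') (hh'.eventually_ge_atTop 10)
    (by simpa only [BatchFilling.load, sub_sub_cancel] using hd) hdN 1
  filter_upwards [hbound, eventually_gt_atTop 1] with N hN hN1 p hp
  simpa only [pow_one, mul_assoc] using (hN p hp).trans <| (pow_one (N : ℝ)).symm ▸
    BatchFilling.one_div_le_five_div_sqrt_mul_log (mod_cast hN1)
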